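/- Let $m\ge 0$ be fixed. For $d\ge m$ let $V$ be a random unitary distributed according to the Haar probability measure on $U(2^d)$, and let $\rho(x)$, $x\in\mathcal X$, be a family of $d$-qubit density matrices (the data embedding). Write $\rho^V(x)=V\rho(x)V^\dagger$, let $\tilde\rho^V_m(x)=\mathrm{tr}_{m+1\ldots d}\,\rho^V(x)\in\mathbb C^{2^m\times 2^m}$ be the reduced density matrix of the first $m$ qubits, and let $q_m^V(x,x')=\mathrm{tr}\big(\tilde\rho^V_m(x)\tilde\rho^V_m(x')\big)$ be the projected kernel. (a) For every $\varepsilon>0$ there is a constant $C=C(m,\varepsilon)$ such that for all $d\ge m$, all embeddings $\rho$ and all $x,x'\in\mathcal X$: with probability at least $1-\varepsilon$ over $V$ all entries of $\tilde\rho^V_m(x)-2^{-m}\mathrm{id}$ are at most $C\,2^{-d/2}$ in absolute value, and with probability at least $1-\varepsilon$ over $V$, $|q_m^V(x,x')-2^{-m}|\le C\,2^{-d/2}$. (b) Suppose moreover that $\mathcal X$ carries a probability measure $\mu$, that $x\mapsto\rho(x)$ is measurable, and that every $\rho(x)$ is pure, $\mathrm{tr}(\rho(x)^2)=1$. Let $T^V_{\mu,m}$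 be the linear map on $\mathbb C^{2^m\times 2^m}$ given by $T^V_{\mu,m}(M)=\mathrm{tr}_2\big(O^V_\mu(\mathrm{id}\otimes M)\big)$, $O^V_\mu=\int\tilde\rho^V_m(y)\otimes\tilde\rho^V_m(y)\,\mu(dy)$. It represents the integral operator of the kernel $q_m^V$ on the functions $f_M(x)=\mathrm{tr}(\tilde\rho^V_m(x)M)$: for all $V$ and $M$, $\int q_m^V(x,y)f_M(y)\,\mu(dy)=f_{T^V_{\mu,m}(M)}(x)$ for every $x\in\mathcal X$. There is a constant $C=C(m)$ such that for all $d\ge m$, all $\mathcal X$, all $\mu$ and all such $\rho$, the averaged operator $\mathbb E_V[T^V_{\mu,m}]$ has an eigenbasis $A_0,\dots,A_{2^{2m}-1}$ of Hermitian matrices that are orthonormal for $\langle A,B\rangle=\mathrm{tr}(A^\dagger B)$, with real eigenvalues $\gamma_0,\dots,\gamma_{2^{2m}-1}$ satisfying $|\gamma_0-2^{-m}|\le C\,2^{-2d}$ and $|\gamma_i-2^{-m-d}|\le C\,2^{-2d}$ for $1\le i\le 2^{2m}-1$; and the eigenfunction $x\mapsto\mathrm{tr}(\tilde\rho^V_m(x)A_0)$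 belonging to $\gamma_0$ is constant up to a relative error $O(2^{-2d})$: there is a real $c\ne 0$ with $|\mathrm{tr}(\tilde\rho^V_m(x)A_0)-c|\le C|c|2^{-2d}$ for all $V\in U(2^d)$ and all $x\in\mathcal X$. -/

import Mathlib

open MeasureTheory
open scoped Kronecker Matrix ComplexOrder

noncomputable section

/-- Labels of the computational basis of `d` qubits, i.e. bit strings of length `d`; operators on
`d` qubits are the `2^d × 2^d` matrices indexed by them. -/
abbrev Bits (d : ℕ) : Type := Fin d → Fin 2

/-- Complex matrices of operators on `d` qubits. -/
abbrev QMat (d : ℕ) : Type := Matrix (Bits d) (Bits d) ℂ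

/-- The unitary group `U(2^d)` acting on `d` qubits. -/
abbrev UnitaryQ (d : ℕ) : Type := Matrix.unitaryGroup (Bits d) ℂ

/-! ### Haar measure on `U(2^d)` -/

instance unitaryQCompactSpace (d : ℕ) : CompactSpace (UnitaryQ d) := by
  have hK : IsCompact (Set.univ.pi fun _ : Bits d => Set.univ.pi fun _ : Bits d =>
      Metric.closedBall (0 : ℂ) 1) :=
    isCompact_univ_pi fun _ => isCompact_univ_pi fun _ => isCompact_closedBall 0 1
  have hc : IsClosed ((Matrix.unitaryGroup (Bits d) ℂ : Set (QMat d))) := by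
    have h : ((Matrix.unitaryGroup (Bits d) ℂ : Set (QMat d))) = {A : QMat d | A * star A = 1} := by
      ext A
      exact Matrix.mem_unitaryGroup_iff
    rw [h]
    exact isClosed_eq (by fun_prop) continuous_const
  refine isCompact_iff_compactSpace.mp (hK.of_isClosed_subset hc ?_)
  intro A hA i _ j _
  simpa using entry_norm_bound_of_unitary hA i j

/-- The Borel σ-algebra on `U(2^d)`. -/
instance unitaryQMeasurableSpace (d : ℕ) : MeasurableSpace (UnitaryQ d) := borel _

instance unitaryQBorelSpace (d : ℕ) : BorelSpace (UnitaryQ d) := ⟨rfl⟩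

/-- The Haar probability measure on `U(2^d)`: the Haar measure with total mass one. -/
def haarU (d : ℕ) : Measure (UnitaryQ d) := Measure.haarMeasure ⊤

instance haarUIsProbabilityMeasure (d : ℕ) : IsProbabilityMeasure (haarU d) :=
  ⟨Measure.haarMeasure_self⟩

/-! ### States, partial traces, reduced states and the projected kernel -/

/-- A density matrix: positive semidefinite (in particular Hermitian) with unit trace. -/
def IsDensity {d : ℕ} (ρ : QMat d) : Prop := ρ.PosSemidef ∧ ρ.trace = 1

/-- The partial trace over the second tensor factor. -/
def ptraceRight {a b : Type*} [Fintype b] (A : Matrix (a × b) (a × b) ℂ) : Matrix a a ℂ :=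
  Matrix.of fun i j => ∑ k, A (i, k) (j, k)

/-- A bit string of length `d` is a pair: its first `m` bits and its last `d - m` bits. -/
def splitBits {m d : ℕ} (h : m ≤ d) : Bits m × Bits (d - m) ≃ Bits d :=
  (Fin.appendEquiv m (d - m)).trans
    (Equiv.arrowCongr (finCongr (Nat.add_sub_of_le h)) (Equiv.refl (Fin 2)))

/-- The reduced density matrix of the first `m` qubits: trace out the qubits `m + 1, …, d`. -/
def reduced {m d : ℕ} (h : m ≤ d) (ρ : QMat d) : QMat m :=
  ptraceRight (ρ.submatrix (splitBits h) (splitBits h))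

/-- `ρ^V = V ρ V†`, the state after the circuit `V`. -/
def evolve {d : ℕ} (V : UnitaryQ d) (ρ : QMat d) : QMat d := V.1 * ρ * V.1ᴴ

/-- The reduced density matrix of the first `m` qubits of `V ρ V†`. -/
def reducedState {m d : ℕ} (h : m ≤ d) (V : UnitaryQ d) (ρ : QMat d) : QMat m :=
  reduced h (evolve V ρ)

/-- The projected kernel of the feature map `ρ` on a space `X`, for the first `m` qubits:
the Hilbert-Schmidt product of the reduced density matrices. -/
def projKernel {m d : ℕ} (h : m ≤ d) {X : Type*} (ρ : X → QMat d) (V : UnitaryQ d)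
    (x x' : X) : ℂ :=
  (reducedState h V (ρ x) * reducedState h V (ρ x')).trace

/-! ### The integral operator and its average over `V` -/

/-- `O = ∫ σ(y) ⊗ σ(y) μ(dy)` for a feature map `σ` into the operators on `m` qubits, the
integral of a matrix-valued function being taken entry by entry. -/
def secondMoment {m : ℕ} {X : Type*} [MeasurableSpace X] (μ : Measure X) (σ : X → QMat m) :
    Matrix (Bits m × Bits m) (Bits m × Bits m) ℂ :=
  Matrix.of fun i j => ∫ y, (σ y ⊗ₖ σ y) i j ∂μ

/-- The integral operator of the kernel `tr (σ(x) σ(x'))` written as a linear map on matrices,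
`T(M) = tr₂ (O (1 ⊗ M))`, where the matrix `M` stands for the function `x ↦ tr (σ(x) M)`. -/
def integralOp {m : ℕ} {X : Type*} [MeasurableSpace X] (μ : Measure X) (σ : X → QMat m) :
    QMat m →ₗ[ℂ] QMat m where
  toFun M := ptraceRight (secondMoment μ σ * ((1 : QMat m) ⊗ₖ M))
  map_add' M N := by
    ext i j
    simp [ptraceRight, Matrix.kronecker_add, Matrix.mul_add, Finset.sum_add_distrib]
  map_smul' c M := by
    ext i j
    simp [ptraceRight, Matrix.kronecker_smul, Finset.mul_sum]

/-- The integral operator of the projected kernel for the circuit `V`. -/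
def projIntegralOp {m d : ℕ} (h : m ≤ d) {X : Type*} [MeasurableSpace X] (μ : Measure X)
    (ρ : X → QMat d) (V : UnitaryQ d) : QMat m →ₗ[ℂ] QMat m :=
  integralOp μ fun y => reducedState h V (ρ y)

/-- The expectation of a random linear map on matrices: the linear map whose matrix entries with
respect to the standard basis (the matrix units) are the expectations of the entries. -/
def expectOp {m : ℕ} {Ω : Type*} [MeasurableSpace Ω] (P : Measure Ω)
    (T : Ω → (QMat m →ₗ[ℂ] QMat m)) : QMat m →ₗ[ℂ] QMat m :=
  Matrix.toLin (Matrix.stdBasis ℂ (Bits m) (Bits m)) (Matrix.stdBasis ℂ (Bits m) (Bits m))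
    (Matrix.of fun i j => ∫ ω, LinearMap.toMatrix (Matrix.stdBasis ℂ (Bits m) (Bits m))
      (Matrix.stdBasis ℂ (Bits m) (Bits m)) (T ω) i j ∂P)

end

/-! ### Density matrices -/

namespace IsDensity

variable {d : ℕ} {ρ : QMat d}

/-! Write `D = 2^d`, `N = 2^m`, `K = 2^(d-m)`, so `D = N * K`. Everything rests on the second moment
of a Haar-random state. By invariance, `E[ρ^V ⊗ ρ^V] = a 1 + b F` with `F` the flip, where `0 ≤ b ≤
a` and `a D² + b D = 1`; purity gives the further relation `a D + b D² = 1`, hence `a = b = 1/(D² +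
D)` when `D > 1` (`exists_pairMoment_eq`). Invariance is used only for permutations, diagonal phases
and one rotation mixing two basis vectors. Tracing out qubits gives `a K² 1 + b K F` for the reduced
state (`integral_reducedState_mul`).

For (a), the mean squared Hilbert-Schmidt distance of the reduced state to the maximally mixed one
is `b K (N² - 1) ≤ 1/K`, and Markov's inequality applies. The kernel inherits the bound because its
second argument has trace one and bounded entries.

For (b), the pure-state moment does not depend on `x`, so Fubini gives the averaged operator `M ↦ a
K² tr(M) 1 + a K M`. Its eigenvectors are the identity, with eigenvalue exactly `1/N`, and the
traceless matrices, with eigenvalue `1/(N (D + 1))`; normalized Pauli strings form a Hermitian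
orthonormal basis adapted to this splitting. The leading eigenfunction is a multiple of `tr σ = 1`,
hence exactly constant. -/

lemma diag_nonneg (hρ : IsDensity ρ) (i : Bits d) : 0 ≤ ρ i i := hρ.1.diag_nonneg

lemma diag_le_one (hρ : IsDensity ρ) (i : Bits d) : ρ i i ≤ 1 := by
  rw [← hρ.2]
  exact Finset.single_le_sum (f := fun i => ρ i i) (fun j _ => hρ.diag_nonneg j)
    (Finset.mem_univ i)

lemma star_apply (hρ : IsDensity ρ) (i j : Bits d) : star (ρ i j) = ρ j i := hρ.1.1.apply j i

/-- This is nonnegativity of a `2 × 2` principal minor; for `i = j` the minor has equal rows and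
vanishes. -/
lemma offDiag_mul_le (hρ : IsDensity ρ) (i j : Bits d) : ρ i j * ρ j i ≤ ρ i i * ρ j j := by
  have h := (hρ.1.submatrix ![i, j]).det_nonneg
  rw [Matrix.det_fin_two] at h
  simpa using h

lemma offDiag_mul_eq (hρ : IsDensity ρ) (i j : Bits d) :
    ρ i j * ρ j i = ((‖ρ i j‖ ^ 2 : ℝ) : ℂ) := by
  rw [← hρ.star_apply i j]
  simpa using Complex.mul_conj' (ρ i j)

lemma norm_apply_le_one (hρ : IsDensity ρ) (i j : Bits d) : ‖ρ i j‖ ≤ 1 := by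
  have h : ((‖ρ i j‖ ^ 2 : ℝ) : ℂ) ≤ ((1 : ℝ) : ℂ) := by
    rw [← hρ.offDiag_mul_eq]
    refine (hρ.offDiag_mul_le i j).trans ?_
    simpa using mul_le_mul (hρ.diag_le_one i) (hρ.diag_le_one j) (hρ.diag_nonneg j) zero_le_one
  have h' := Complex.real_le_real.1 h
  nlinarith [norm_nonneg (ρ i j)]

lemma evolve (hρ : IsDensity ρ) (V : UnitaryQ d) : IsDensity (evolve V ρ) := by
  refine ⟨hρ.1.mul_mul_conjTranspose_same V.1, ?_⟩
  have hV : V.1ᴴ * V.1 = 1 := Matrix.mem_unitaryGroup_iff'.1 V.2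
  rw [_root_.evolve, Matrix.trace_mul_comm, ← Matrix.mul_assoc, hV, Matrix.one_mul, hρ.2]

end IsDensity

lemma reduced_apply {m d : ℕ} (h : m ≤ d) (ρ : QMat d) (α β : Bits m) :
    reduced h ρ α β = ∑ s, ρ (splitBits h (α, s)) (splitBits h (β, s)) := rfl

lemma IsDensity.reduced {m d : ℕ} (h : m ≤ d) {ρ : QMat d} (hρ : IsDensity ρ) :
    IsDensity (reduced h ρ) := by
  constructor
  · have : _root_.reduced h ρ = ∑ s, ρ.submatrix (fun α => splitBits h (α, s))
        (fun α => splitBits h (α, s)) := by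
      ext α β
      simp [reduced_apply, Matrix.sum_apply]
    rw [this]
    exact Matrix.posSemidef_sum _ fun s _ => hρ.1.submatrix _
  · rw [← hρ.2]
    simp only [Matrix.trace, Matrix.diag, reduced_apply]
    rw [← (splitBits h).sum_comp, Fintype.sum_prod_type]

lemma IsDensity.reducedState {m d : ℕ} (h : m ≤ d) {ρ : QMat d} (hρ : IsDensity ρ)
    (V : UnitaryQ d) : IsDensity (reducedState h V ρ) :=
  (hρ.evolve V).reduced h

/-! ### Second moments of `V ρ V†` -/

instance haarUIsMulLeftInvariant (d : ℕ) : (haarU d).IsMulLeftInvariant := by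
  unfold haarU
  infer_instance

lemma evolve_mul {d : ℕ} (U V : UnitaryQ d) (ρ : QMat d) :
    evolve (U * V) ρ = U.1 * evolve V ρ * U.1ᴴ := by
  simp [evolve, Matrix.mul_assoc]

lemma evolve_apply {d : ℕ} (V : UnitaryQ d) (ρ : QMat d) (i j : Bits d) :
    evolve V ρ i j = ∑ b, (∑ a, V.1 i a * ρ a b) * star (V.1 j b) := by
  simp [evolve, Matrix.mul_apply]

lemma continuous_evolve_apply {d : ℕ} (ρ : QMat d) (i j : Bits d) :
    Continuous fun V : UnitaryQ d => evolve V ρ i j := by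
  unfold evolve
  fun_prop

lemma continuous_reducedState_apply {m d : ℕ} (h : m ≤ d) (ρ : QMat d) (α β : Bits m) :
    Continuous fun V : UnitaryQ d => reducedState h V ρ α β := by
  simp only [reducedState, reduced_apply]
  exact continuous_finsetSum _ fun s _ => continuous_evolve_apply ρ _ _

lemma Continuous.integrable_haarU {d : ℕ} {E : Type*} [NormedAddCommGroup E]
    {f : UnitaryQ d → E} (hf : Continuous f) : Integrable f (haarU d) := by
  have : IsFiniteMeasureOnCompacts (haarU d) := inferInstance
  exact hf.integrable_of_hasCompactSupport (HasCompactSupport.of_compactSpace f)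

/-- The second moment `E[(V ρ V†)ᵢⱼ (V ρ V†)ₖₗ]` over the Haar measure. -/
noncomputable def pairMoment {d : ℕ} (ρ : QMat d) (i j k l : Bits d) : ℂ :=
  ∫ V, evolve V ρ i j * evolve V ρ k l ∂haarU d

lemma integrable_evolve_mul {d : ℕ} (ρ : QMat d) (i j k l : Bits d) :
    Integrable (fun V => evolve V ρ i j * evolve V ρ k l) (haarU d) :=
  ((continuous_evolve_apply ρ i j).mul (continuous_evolve_apply ρ k l)).integrable_haarU

lemma pairMoment_eq_integral_mul_left {d : ℕ} (ρ : QMat d) (U : UnitaryQ d) (i j k l : Bits d) :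
    pairMoment ρ i j k l
      = ∫ V, evolve (U * V) ρ i j * evolve (U * V) ρ k l ∂haarU d :=
  (integral_mul_left_eq_self (fun V => evolve V ρ i j * evolve V ρ k l) U).symm

lemma pairMoment_perm {d : ℕ} (ρ : QMat d) (σ : Equiv.Perm (Bits d)) (i j k l : Bits d) :
    pairMoment ρ i j k l = pairMoment ρ (σ i) (σ j) (σ k) (σ l) := by
  have hU : σ.permMatrix ℂ ∈ Matrix.unitaryGroup (Bits d) ℂ := by
    rw [Matrix.mem_unitaryGroup_iff, Matrix.star_eq_conjTranspose, Matrix.conjTranspose_permMatrix,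
      ← Matrix.permMatrix_mul]
    simp
  have h (V : UnitaryQ d) (i j : Bits d) :
      evolve ((⟨σ.permMatrix ℂ, hU⟩ : UnitaryQ d) * V) ρ i j = evolve V ρ (σ i) (σ j) := by
    rw [evolve_mul, Matrix.conjTranspose_permMatrix]
    simp only [Equiv.Perm.permMatrix, PEquiv.toMatrix_toPEquiv_mul, PEquiv.mul_toMatrix_toPEquiv]
    simp [Equiv.Perm.inv_def]
  rw [pairMoment_eq_integral_mul_left ρ ⟨σ.permMatrix ℂ, hU⟩]
  simp only [h]
  rfl

lemma pairMoment_phase {d : ℕ} (ρ : QMat d) (u : Bits d → ℂ) (hu : ∀ i, u i * star (u i) = 1)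
    (i j k l : Bits d) :
    pairMoment ρ i j k l = u i * star (u j) * (u k * star (u l)) * pairMoment ρ i j k l := by
  have hU : Matrix.diagonal u ∈ Matrix.unitaryGroup (Bits d) ℂ := by
    rw [Matrix.mem_unitaryGroup_iff, Matrix.star_eq_conjTranspose, Matrix.diagonal_conjTranspose,
      Matrix.diagonal_mul_diagonal]
    simp only [Pi.star_apply, hu, Matrix.diagonal_one]
  have h (V : UnitaryQ d) (i j : Bits d) :
      evolve ((⟨Matrix.diagonal u, hU⟩ : UnitaryQ d) * V) ρ i j
        = u i * evolve V ρ i j * star (u j) := by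
    rw [evolve_mul, Matrix.diagonal_conjTranspose, Matrix.mul_diagonal, Matrix.diagonal_mul]
    rfl
  conv_lhs => rw [pairMoment_eq_integral_mul_left ρ ⟨Matrix.diagonal u, hU⟩]
  simp only [h]
  rw [pairMoment, ← integral_const_mul]
  congr 1 with V
  ring

/-- Second moments vanish unless the row indices agree with the column indices up to order. -/
lemma pairMoment_eq_zero {d : ℕ} (ρ : QMat d) {i j k l : Bits d} (h₁ : ¬(i = j ∧ k = l))
    (h₂ : ¬(i = l ∧ j = k)) : pairMoment ρ i j k l = 0 := by
  -- The moment is multiplied by `I` to the power (occurrences of `s` among the row indices `i, k`)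
  -- minus (occurrences among the column indices `j, l`). The phase `-1` would not suffice: it
  -- cannot detect an index occurring twice as a row and never as a column.
  have key (s : Bits d) := pairMoment_phase ρ (fun t => if t = s then Complex.I else 1)
    (fun t => by split_ifs <;> simp) i j k l
  have ne (z : ℂ) (hz : z ≠ 1) (hk : pairMoment ρ i j k l = z * pairMoment ρ i j k l) :
      pairMoment ρ i j k l = 0 := by
    have : (z - 1) * pairMoment ρ i j k l = 0 := by rw [sub_mul, ← hk]; ring
    exact (mul_eq_zero.1 this).resolve_left (sub_ne_zero.2 hz)
  have hI : Complex.I ≠ 1 := fun h => by simpa using congrArg Complex.re h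
  have hI' : -Complex.I ≠ 1 := fun h => by simpa using congrArg Complex.re h
  have hn : (-1 : ℂ) ≠ 1 := by norm_num
  by_cases hij : i = j
  · have hkl : k ≠ l := fun h => h₁ ⟨hij, h⟩
    subst hij
    refine ne _ ?_ (key k)
    by_cases hik : i = k <;> simp [hik, hkl.symm, hI]
  · by_cases hil : i = l
    · have hjk : j ≠ k := fun h => h₂ ⟨hil, h⟩
      subst hil
      refine ne _ ?_ (key j)
      simp [hij, hjk.symm, hI']
    · refine ne _ ?_ (key i)
      by_cases hik : k = i <;> simp [hik, Ne.symm hij, Ne.symm hil, hI, hn]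

lemma pairMoment_swap {d : ℕ} (ρ : QMat d) (i j k l : Bits d) :
    pairMoment ρ i j k l = pairMoment ρ k l i j := by
  simp only [pairMoment, mul_comm]

/-- The rotation `(1 + i S) / √2`, `S` being a transposition, relates the second moments. -/
lemma pairMoment_diag {d : ℕ} (ρ : QMat d) {i k : Bits d} (hik : i ≠ k) :
    pairMoment ρ i i i i = pairMoment ρ i i k k + pairMoment ρ i k k i := by
  set S : QMat d := (Equiv.swap i k).permMatrix ℂ with hS
  have hSt : Sᴴ = S := by rw [hS, Matrix.conjTranspose_permMatrix, Equiv.swap_inv]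
  have hSS : S * S = 1 := by rw [hS, ← Matrix.permMatrix_mul]; simp
  have hr : ((√2 : ℝ) : ℂ)⁻¹ * ((√2 : ℝ) : ℂ)⁻¹ = 2⁻¹ := by
    rw [← mul_inv, ← Complex.ofReal_mul]; simp
  set W : QMat d := ((√2 : ℝ) : ℂ)⁻¹ • (1 + Complex.I • S) with hW
  have hWt : Wᴴ = ((√2 : ℝ) : ℂ)⁻¹ • (1 - Complex.I • S) := by
    simp [hW, hSt, Matrix.conjTranspose_smul, sub_eq_add_neg]
  have hU : W ∈ Matrix.unitaryGroup (Bits d) ℂ := by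
    rw [Matrix.mem_unitaryGroup_iff, Matrix.star_eq_conjTranspose, hWt, hW,
      Matrix.smul_mul, Matrix.mul_smul, smul_smul, hr, Matrix.add_mul, Matrix.mul_sub,
      Matrix.mul_sub]
    simp only [Matrix.one_mul, Matrix.mul_one, Matrix.smul_mul, Matrix.mul_smul, hSS, smul_smul,
      Complex.I_mul_I]
    rw [show (1 : QMat d) - Complex.I • S + (Complex.I • S - (-1 : ℂ) • (1 : QMat d))
      = (2 : ℂ) • (1 : QMat d) by module, smul_smul]
    norm_num
  have h (V : UnitaryQ d) : evolve ((⟨W, hU⟩ : UnitaryQ d) * V) ρ i i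
      = 2⁻¹ * (evolve V ρ i i + evolve V ρ k k + Complex.I * evolve V ρ k i
        - Complex.I * evolve V ρ i k) := by
    rw [evolve_mul]
    change (W * evolve V ρ * Wᴴ) i i = _
    rw [hWt, hW, Matrix.smul_mul, Matrix.smul_mul, Matrix.mul_smul, smul_smul, hr, Matrix.add_mul,
      Matrix.mul_sub, Matrix.add_mul]
    simp only [Matrix.one_mul, Matrix.mul_one, Matrix.smul_mul, Matrix.mul_smul, Matrix.add_mul,
      Matrix.smul_apply, Matrix.sub_apply, Matrix.add_apply, smul_eq_mul]
    have h1 (A : QMat d) (a b : Bits d) : (S * A) a b = A (Equiv.swap i k a) b := by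
      simp only [hS, Equiv.Perm.permMatrix, PEquiv.toMatrix_toPEquiv_mul]; rfl
    have h2 (A : QMat d) (a b : Bits d) : (A * S) a b = A a (Equiv.swap i k b) := by
      simp only [hS, Equiv.Perm.permMatrix, PEquiv.mul_toMatrix_toPEquiv]
      simp
    simp only [h1, h2, Equiv.swap_apply_left]
    linear_combination -(1 / 2) * evolve V ρ k k * Complex.I_sq
  -- The four summands of the rotated entry, at positions `(i,i), (k,k), (k,i), (i,k)`, are indexed
  -- by `Fin 4`, so that the square is a sum of sixteen second moments.
  have e (V : UnitaryQ d) : evolve ((⟨W, hU⟩ : UnitaryQ d) * V) ρ i i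
      * evolve ((⟨W, hU⟩ : UnitaryQ d) * V) ρ i i
      = ∑ p : Fin 4, ∑ q : Fin 4, 4⁻¹ * (![1, 1, Complex.I, -Complex.I] p
        * ![1, 1, Complex.I, -Complex.I] q) * (evolve V ρ (![i, k, k, i] p) (![i, k, i, k] p)
          * evolve V ρ (![i, k, k, i] q) (![i, k, i, k] q)) := by
    rw [h]
    simp [Fin.sum_univ_four]
    linear_combination (1 / 4) * (evolve V ρ k i - evolve V ρ i k) ^ 2 * Complex.I_sq
  have main : pairMoment ρ i i i i = ∑ p : Fin 4, ∑ q : Fin 4,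
      4⁻¹ * (![1, 1, Complex.I, -Complex.I] p * ![1, 1, Complex.I, -Complex.I] q)
        * pairMoment ρ (![i, k, k, i] p) (![i, k, i, k] p) (![i, k, k, i] q) (![i, k, i, k] q) := by
    rw [pairMoment_eq_integral_mul_left ρ ⟨W, hU⟩]
    simp only [e]
    rw [integral_finsetSum _ fun p _ => integrable_finsetSum _ fun q _ =>
      (integrable_evolve_mul ρ _ _ _ _).const_mul _]
    refine Finset.sum_congr rfl fun p _ => ?_
    rw [integral_finsetSum _ fun q _ => (integrable_evolve_mul ρ _ _ _ _).const_mul _]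
    exact Finset.sum_congr rfl fun q _ => integral_const_mul _ _
  have z {a b c e : Bits d} (h₁ : ¬(a = b ∧ c = e)) (h₂ : ¬(a = e ∧ b = c)) :=
    pairMoment_eq_zero ρ h₁ h₂
  have hkk : pairMoment ρ k k k k = pairMoment ρ i i i i := by
    simpa using pairMoment_perm ρ (Equiv.swap i k) k k k k
  simp [Fin.sum_univ_four] at main
  -- Ten of the sixteen moments vanish. The survivors give `4 M = 2 M + 2 (M' + M'')`, with `M` the
  -- diagonal moment and `M'`, `M''` those on the right of the claim.
  rw [z (a := i) (b := i) (c := k) (e := i) (by grind) (by grind),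
    z (a := i) (b := i) (c := i) (e := k) (by grind) (by grind),
    z (a := k) (b := k) (c := k) (e := i) (by grind) (by grind),
    z (a := k) (b := k) (c := i) (e := k) (by grind) (by grind),
    z (a := k) (b := i) (c := i) (e := i) (by grind) (by grind),
    z (a := k) (b := i) (c := k) (e := k) (by grind) (by grind),
    z (a := k) (b := i) (c := k) (e := i) (by grind) (by grind),
    z (a := i) (b := k) (c := i) (e := i) (by grind) (by grind),
    z (a := i) (b := k) (c := k) (e := k) (by grind) (by grind),
    z (a := i) (b := k) (c := i) (e := k) (by grind) (by grind),
    hkk, pairMoment_swap ρ k k i i, pairMoment_swap ρ k i i k] at main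
  linear_combination 2 * main

lemma integral_const_one_haarU (d : ℕ) : ∫ _ : UnitaryQ d, (1 : ℂ) ∂haarU d = 1 := by
  simp

lemma sum_pairMoment_diag {d : ℕ} {ρ : QMat d} (hρ : IsDensity ρ) :
    ∑ i, ∑ k, pairMoment ρ i i k k = 1 := by
  have h (V : UnitaryQ d) : ∑ i, ∑ k, evolve V ρ i i * evolve V ρ k k = 1 := by
    have := (hρ.evolve V).2
    simp only [Matrix.trace, Matrix.diag] at this
    rw [← Finset.sum_mul_sum, this, one_mul]
  simp only [pairMoment]
  rw [← integral_const_one_haarU d, ← integral_congr_ae (.of_forall h),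
    integral_finsetSum _ fun i _ => integrable_finsetSum _ fun k _ => integrable_evolve_mul ρ _ _ _ _]
  exact Finset.sum_congr rfl fun i _ =>
    (integral_finsetSum _ fun k _ => integrable_evolve_mul ρ _ _ _ _).symm

/-- Conjugation by a unitary preserves `tr ρ²`, so the integrand is constant. For pure states this
supplies the second linear equation for `a` and `b`. -/
lemma sum_pairMoment_offDiag {d : ℕ} (ρ : QMat d) :
    ∑ i, ∑ k, pairMoment ρ i k k i = (ρ * ρ).trace := by
  have h (V : UnitaryQ d) : ∑ i, ∑ k, evolve V ρ i k * evolve V ρ k i = (ρ * ρ).trace := by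
    have hV : V.1ᴴ * V.1 = 1 := Matrix.mem_unitaryGroup_iff'.1 V.2
    have e : (evolve V ρ * evolve V ρ).trace = (ρ * ρ).trace := by
      have : evolve V ρ * evolve V ρ = V.1 * (ρ * ρ * V.1ᴴ) := by
        calc V.1 * ρ * V.1ᴴ * (V.1 * ρ * V.1ᴴ) = V.1 * ρ * (V.1ᴴ * V.1) * ρ * V.1ᴴ := by
              simp only [Matrix.mul_assoc]
          _ = _ := by rw [hV]; simp only [Matrix.mul_assoc, Matrix.one_mul]
      rw [this, Matrix.trace_mul_comm, Matrix.mul_assoc, hV, Matrix.mul_one]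
    rw [← e]
    simp [Matrix.trace, Matrix.mul_apply]
  simp only [pairMoment]
  rw [← mul_one (ρ * ρ).trace, ← integral_const_one_haarU d, ← integral_const_mul]
  simp only [mul_one]
  rw [← integral_congr_ae (.of_forall h),
    integral_finsetSum _ fun i _ => integrable_finsetSum _ fun k _ => integrable_evolve_mul ρ _ _ _ _]
  exact Finset.sum_congr rfl fun i _ =>
    (integral_finsetSum _ fun k _ => integrable_evolve_mul ρ _ _ _ _).symm

lemma card_bits (d : ℕ) : Fintype.card (Bits d) = 2 ^ d := by simp

/-- Two-transitivity of the symmetric group: one moment at a fixed pair of distinct indices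
determines those at all such pairs. -/
lemma exists_perm_map_pair {α : Type*} [DecidableEq α] {a b i k : α} (hab : a ≠ b) (hik : i ≠ k) :
    ∃ σ : Equiv.Perm α, σ a = i ∧ σ b = k := by
  have h : Equiv.swap a i b ≠ i := fun h => hab
    ((Equiv.swap a i).injective (by rw [Equiv.swap_apply_left, h]))
  exact ⟨Equiv.swap (Equiv.swap a i b) k * Equiv.swap a i, by
    simp [Equiv.swap_apply_of_ne_of_ne h.symm hik], by simp⟩

/-- The second moments of a Haar-random density matrix: `E[ρ^V ⊗ ρ^V] = a 1 + b F`, where `F` is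
the flip, in coordinates. -/
lemma exists_pairMoment_eq {d : ℕ} {ρ : QMat d} (hρ : IsDensity ρ) :
    ∃ a b : ℝ, 0 ≤ b ∧ b ≤ a ∧ a * (2 ^ d) ^ 2 + b * 2 ^ d = 1 ∧ ((ρ * ρ).trace = 1 → a = b) ∧
      ∀ i j k l, pairMoment ρ i j k l = a * ((if i = j then 1 else 0) * if k = l then 1 else 0)
        + b * ((if i = l then 1 else 0) * if j = k then 1 else 0) := by
  have hdiag := sum_pairMoment_diag hρ
  rcases subsingleton_or_nontrivial (Bits d) with hs | hn
  · have hc : Fintype.card (Bits d) = 1 := Fintype.card_eq_one_iff.2 ⟨0, fun _ => Subsingleton.elim _ _⟩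
    have hD : (2 : ℝ) ^ d = 1 := by rw [card_bits] at hc; exact_mod_cast hc
    -- With a single basis vector, `1` and `F` coincide and only `a + b = 1` is determined; the
    -- equal choice also meets the purity clause.
    refine ⟨1 / 2, 1 / 2, by norm_num, le_rfl, by rw [hD]; norm_num, fun _ => rfl, ?_⟩
    intro i j k l
    have e (x : Bits d) : x = 0 := Subsingleton.elim _ _
    simp only [e, Finset.sum_const, Finset.card_univ, hc, one_smul] at hdiag
    simp only [e, hdiag]
    norm_num
  · obtain ⟨p, q, hpq⟩ := exists_pair_ne (Bits d)
    have hb : 0 ≤ pairMoment ρ p q q p := by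
      refine integral_nonneg fun V => ?_
      change 0 ≤ evolve V ρ p q * evolve V ρ q p
      rw [(hρ.evolve V).offDiag_mul_eq]
      exact Complex.zero_le_real.2 (sq_nonneg _)
    have hab : pairMoment ρ p q q p ≤ pairMoment ρ p p q q :=
      integral_mono (integrable_evolve_mul ρ _ _ _ _) (integrable_evolve_mul ρ _ _ _ _)
        fun V => (hρ.evolve V).offDiag_mul_le p q
    obtain ⟨b, hb', hb⟩ : ∃ b : ℝ, 0 ≤ b ∧ pairMoment ρ p q q p = b :=
      ⟨_, (Complex.nonneg_iff.1 hb).1, (Complex.ext rfl (Complex.nonneg_iff.1 hb).2.symm)⟩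
    obtain ⟨a, ha⟩ : ∃ a : ℝ, pairMoment ρ p p q q = a := by
      refine ⟨(pairMoment ρ p p q q).re, Complex.ext rfl ?_⟩
      rw [← (Complex.le_def.1 hab).2, hb]
      simp
    rw [ha, hb, Complex.real_le_real] at hab
    have formula : ∀ i j k l, pairMoment ρ i j k l
        = a * ((if i = j then 1 else 0) * if k = l then 1 else 0)
          + b * ((if i = l then 1 else 0) * if j = k then 1 else 0) := by
      have h1 {i k : Bits d} (hik : i ≠ k) : pairMoment ρ i i k k = a := by
        obtain ⟨σ, rfl, rfl⟩ := exists_perm_map_pair hpq hik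
        rw [← ha, ← pairMoment_perm]
      have h2 {i k : Bits d} (hik : i ≠ k) : pairMoment ρ i k k i = b := by
        obtain ⟨σ, rfl, rfl⟩ := exists_perm_map_pair hpq hik
        rw [← hb, ← pairMoment_perm]
      have h3 (i : Bits d) : pairMoment ρ i i i i = a + b := by
        obtain ⟨k, hk⟩ := exists_ne i
        rw [pairMoment_diag ρ hk.symm, h1 hk.symm, h2 hk.symm]
      intro i j k l
      by_cases hij : i = j
      · subst hij
        by_cases hkl : k = l
        · subst hkl
          by_cases hik : i = k
          · subst hik
            simp [h3]
          · simp [h1 hik, hik]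
        · rw [pairMoment_eq_zero ρ (by tauto) (by grind)]
          by_cases hil : i = l <;> by_cases hik : i = k <;> simp [*] <;> grind
      · by_cases h : i = l ∧ j = k
        · obtain ⟨rfl, rfl⟩ := h
          simp [h2 hij, hij]
        · rw [pairMoment_eq_zero ρ (by tauto) h]
          by_cases hil : i = l <;> by_cases hjk : j = k <;> simp [*] <;> grind
    have e1 : a * (2 ^ d) ^ 2 + b * 2 ^ d = 1 := by
      simp only [formula] at hdiag
      simp [Finset.sum_add_distrib] at hdiag
      have : ((a * (2 ^ d) ^ 2 + b * 2 ^ d : ℝ) : ℂ) = (1 : ℝ) := by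
        push_cast; linear_combination hdiag
      exact_mod_cast this
    refine ⟨a, b, hb', hab, e1, fun hpure => ?_, formula⟩
    have hoff := sum_pairMoment_offDiag ρ
    rw [hpure] at hoff
    simp only [formula] at hoff
    simp [Finset.sum_add_distrib] at hoff
    have e2 : a * 2 ^ d + b * (2 ^ d) ^ 2 = 1 := by
      have : ((a * 2 ^ d + b * (2 ^ d) ^ 2 : ℝ) : ℂ) = (1 : ℝ) := by
        push_cast; linear_combination hoff
      exact_mod_cast this
    have hD : (1 : ℝ) < 2 ^ d := by
      have := Fintype.one_lt_card (α := Bits d)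
      rw [card_bits] at this
      exact_mod_cast this
    -- Subtracting the two trace equations gives `(a - b) D (D - 1) = 0`, and `D > 1` here.
    have : (a - b) * (2 ^ d * (2 ^ d - 1)) = 0 := by linear_combination e1 - e2
    rcases mul_eq_zero.1 this with h | h
    · linarith
    · nlinarith

/-! ### Second moments of the reduced state -/

/-- The second moments of the reduced state, in terms of those of the full state. -/
lemma integral_reducedState_mul {m d : ℕ} (h : m ≤ d) {ρ : QMat d} {a b : ℝ}
    (hab : ∀ i j k l, pairMoment ρ i j k l
      = a * ((if i = j then 1 else 0) * if k = l then 1 else 0)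
        + b * ((if i = l then 1 else 0) * if j = k then 1 else 0)) (α β γ δ : Bits m) :
    ∫ V, reducedState h V ρ α β * reducedState h V ρ γ δ ∂haarU d
      = a * (2 ^ (d - m)) ^ 2 * ((if α = β then 1 else 0) * if γ = δ then 1 else 0)
        + b * 2 ^ (d - m) * ((if α = δ then 1 else 0) * if β = γ then 1 else 0) := by
  simp only [reducedState, reduced_apply, Finset.sum_mul_sum]
  rw [integral_finsetSum _ fun s _ => integrable_finsetSum _ fun t _ =>
    integrable_evolve_mul ρ _ _ _ _]
  -- The identity part contributes for every pair `(s, t)` of traced-out strings, the flip part only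
  -- for `s = t`; hence the factors `K²` and `K`.
  have : ∀ s ∈ (Finset.univ : Finset (Bits (d - m))),
      ∫ V, ∑ t, evolve V ρ (splitBits h (α, s)) (splitBits h (β, s))
        * evolve V ρ (splitBits h (γ, t)) (splitBits h (δ, t)) ∂haarU d
      = ∑ t, ((a : ℂ) * ((if α = β then 1 else 0) * if γ = δ then 1 else 0)
        + b * (((if α = δ then 1 else 0) * if β = γ then 1 else 0) * if s = t then 1 else 0)) := by
    intro s _
    rw [integral_finsetSum _ fun t _ => integrable_evolve_mul ρ _ _ _ _]
    refine Finset.sum_congr rfl fun t _ => ?_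
    change pairMoment ρ _ _ _ _ = _
    rw [hab]
    simp only [(splitBits h).injective.eq_iff, Prod.mk.injEq, and_true]
    by_cases hst : s = t <;> simp [hst]
  rw [Finset.sum_congr rfl this]
  simp only [Finset.sum_add_distrib, ← Finset.mul_sum, Finset.sum_ite_eq, Finset.sum_const,
    Finset.card_univ, card_bits, Finset.mem_univ, if_true, nsmul_eq_mul]
  push_cast
  ring

/-! ### Concentration of the reduced state -/

/-- Squared Hilbert-Schmidt distance to the maximally mixed state. -/
noncomputable def mixedDist {m : ℕ} (σ : QMat m) : ℝ :=
  ∑ α, ∑ β, ‖(σ - ((2 : ℂ) ^ m)⁻¹ • (1 : QMat m)) α β‖ ^ 2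

/-- Hermiticity turns squared moduli into products of entries, and unit trace makes the cross terms
constant, so the Haar average reduces to second moments. -/
lemma mixedDist_eq {m : ℕ} {σ : QMat m} (hσ : IsDensity σ) :
    (mixedDist σ : ℂ) = ∑ α, ∑ β, σ α β * σ β α - ((2 : ℂ) ^ m)⁻¹ := by
  set c : ℂ := ((2 : ℂ) ^ m)⁻¹ with hc
  have hstar : (starRingEnd ℂ) c = c :=
    Complex.conj_eq_iff_real.2 ⟨(2 ^ m)⁻¹, by simp [hc]⟩
  have e (α β : Bits m) : (‖(σ - c • (1 : QMat m)) α β‖ : ℂ) ^ 2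
      = σ α β * σ β α - (if α = β then 2 * c * σ α α - c ^ 2 else 0) := by
    rw [← Complex.mul_conj']
    have := hσ.star_apply α β
    rw [RCLike.star_def] at this
    by_cases h : α = β
    · subst h
      simp [this, hstar]
      ring
    · simp [h, this]
  have ht : ∑ α, σ α α = 1 := hσ.2
  rw [mixedDist, ← hc]
  push_cast
  simp only [e, Finset.sum_sub_distrib, Finset.sum_ite_eq, Finset.mem_univ, if_true,
    ← Finset.mul_sum, ht, Finset.sum_const, Finset.card_univ, card_bits, nsmul_eq_mul]
  have : (2 : ℂ) ^ m * c = 1 := mul_inv_cancel₀ (by positivity)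
  push_cast
  linear_combination c * this

lemma continuous_mixedDist_reducedState {m d : ℕ} (h : m ≤ d) (ρ : QMat d) :
    Continuous fun V : UnitaryQ d => mixedDist (reducedState h V ρ) := by
  unfold mixedDist
  exact continuous_finsetSum _ fun α _ => continuous_finsetSum _ fun β _ =>
    ((continuous_reducedState_apply h ρ α β).sub continuous_const).norm.pow 2

lemma integral_mixedDist_le {m d : ℕ} (h : m ≤ d) {ρ : QMat d} (hρ : IsDensity ρ) :
    ∫ V, mixedDist (reducedState h V ρ) ∂haarU d ≤ 2 ^ m / 2 ^ d := by
  obtain ⟨a, b, hb, hba, hD, -, hab⟩ := exists_pairMoment_eq hρ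
  have hσ (V : UnitaryQ d) := mixedDist_eq (hρ.reducedState h V)
  have hint (α β : Bits m) : Integrable
      (fun V => reducedState h V ρ α β * reducedState h V ρ β α) (haarU d) :=
    ((continuous_reducedState_apply h ρ α β).mul
      (continuous_reducedState_apply h ρ β α)).integrable_haarU
  have e : ((∫ V, mixedDist (reducedState h V ρ) ∂haarU d : ℝ) : ℂ)
      = ((a * (2 ^ (d - m)) ^ 2 * 2 ^ m + b * 2 ^ (d - m) * (2 ^ m) ^ 2 - (2 ^ m)⁻¹ : ℝ) : ℂ) := by
    rw [← integral_complex_ofReal]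
    simp only [hσ]
    rw [integral_sub (integrable_finsetSum _ fun α _ => integrable_finsetSum _ fun β _ => hint α β)
      (integrable_const _), integral_finsetSum _ fun α _ => integrable_finsetSum _ fun β _ =>
        hint α β]
    simp only [integral_finsetSum _ fun β _ => hint _ β, integral_reducedState_mul h hab]
    simp [Finset.sum_add_distrib]
    ring
  rw [Complex.ofReal_inj.1 e]
  have hd : (2 : ℝ) ^ d = 2 ^ m * 2 ^ (d - m) := by rw [← pow_add, Nat.add_sub_of_le h]
  rw [hd] at hD ⊢
  set N : ℝ := 2 ^ m
  set K : ℝ := 2 ^ (d - m)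
  have hN : 1 ≤ N := one_le_pow₀ (by norm_num)
  have hK : 1 ≤ K := one_le_pow₀ (by norm_num)
  -- Since `b ≤ a`, the normalization bounds `b` by `1/D²`.
  have hbD : b * (N * K) ^ 2 ≤ 1 := by
    have : b * (N * K) ^ 2 ≤ a * (N * K) ^ 2 := by gcongr
    have : 0 ≤ b * (N * K) := by positivity
    linarith
  -- Dividing the normalization by `N` cancels the leading terms of the variance, leaving `b K (N² -
  -- 1)`.
  have h1 : a * K ^ 2 * N + b * K = N⁻¹ := by
    field_simp
    linarith
  have h2 : N / (N * K) = K⁻¹ := by field_simp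
  have h3 : b * K * N ^ 2 ≤ K⁻¹ := by
    rw [← one_div, le_div_iff₀ (by positivity)]
    linarith
  have h4 : 0 ≤ b * K := by positivity
  linarith

lemma norm_sub_le_sqrt_mixedDist {m : ℕ} (σ : QMat m) (α β : Bits m) :
    ‖(σ - ((2 : ℂ) ^ m)⁻¹ • (1 : QMat m)) α β‖ ≤ √(mixedDist σ) := by
  refine Real.le_sqrt_of_sq_le ?_
  rw [mixedDist]
  refine le_trans ?_ (Finset.single_le_sum (f := fun α => ∑ β,
    ‖(σ - ((2 : ℂ) ^ m)⁻¹ • (1 : QMat m)) α β‖ ^ 2)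
    (fun _ _ => Finset.sum_nonneg fun _ _ => sq_nonneg _) (Finset.mem_univ α))
  exact Finset.single_le_sum (f := fun β => ‖(σ - ((2 : ℂ) ^ m)⁻¹ • (1 : QMat m)) α β‖ ^ 2)
    (fun _ _ => sq_nonneg _) (Finset.mem_univ β)

/-- As `tr τ = 1`, the difference is `tr((σ - 1/N) τ)`. Only `σ` has to be close to maximally mixed,
so the kernel estimate needs one good event rather than a union bound. -/
lemma norm_trace_mul_sub_le {m : ℕ} {σ τ : QMat m} (hτ : IsDensity τ) {r : ℝ}
    (hr : ∀ α β, ‖(σ - ((2 : ℂ) ^ m)⁻¹ • (1 : QMat m)) α β‖ ≤ r) :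
    ‖(σ * τ).trace - ((2 : ℂ) ^ m)⁻¹‖ ≤ (2 ^ m) ^ 2 * r := by
  have e : (σ * τ).trace - ((2 : ℂ) ^ m)⁻¹
      = ((σ - ((2 : ℂ) ^ m)⁻¹ • (1 : QMat m)) * τ).trace := by
    simp [Matrix.sub_mul, Matrix.trace_sub, hτ.2]
  rw [e]
  simp only [Matrix.trace, Matrix.diag, Matrix.mul_apply]
  calc _ ≤ ∑ _α : Bits m, ∑ _β : Bits m, r :=
        norm_sum_le_of_le _ fun α _ => norm_sum_le_of_le _ fun β _ => by
          rw [norm_mul]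
          exact (mul_le_of_le_one_right (norm_nonneg _) (hτ.norm_apply_le_one β α)).trans (hr α β)
    _ = _ := by simp; ring

/-- Markov's inequality for the distance of the reduced state to the maximally mixed state. -/
lemma le_haarU_mixedDist_lt {m d : ℕ} (h : m ≤ d) {ρ : QMat d} (hρ : IsDensity ρ) {ε : ℝ}
    (hε : 0 < ε) :
    1 - ε ≤ (haarU d).real {V | mixedDist (reducedState h V ρ) < 2 ^ m / ε / 2 ^ d} := by
  have hc := continuous_mixedDist_reducedState h ρ
  have hM := mul_meas_ge_le_integral_of_nonneg (μ := haarU d)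
    (f := fun V => mixedDist (reducedState h V ρ))
    (.of_forall fun V => Finset.sum_nonneg fun _ _ => Finset.sum_nonneg fun _ _ => sq_nonneg _)
    hc.integrable_haarU (2 ^ m / ε / 2 ^ d)
  have hS : MeasurableSet {V : UnitaryQ d | 2 ^ m / ε / 2 ^ d ≤ mixedDist (reducedState h V ρ)} :=
    (isClosed_le continuous_const hc).measurableSet
  have hcompl := probReal_compl_eq_one_sub (μ := haarU d) hS
  have : {V : UnitaryQ d | mixedDist (reducedState h V ρ) < 2 ^ m / ε / 2 ^ d}
      = {V : UnitaryQ d | 2 ^ m / ε / 2 ^ d ≤ mixedDist (reducedState h V ρ)}ᶜ := by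
    ext V
    simp
  rw [this, hcompl]
  have hle := hM.trans (integral_mixedDist_le h hρ)
  -- The Markov threshold is the bound on the mean divided by `ε`.
  have e : (2 : ℝ) ^ m / ε / 2 ^ d = 2 ^ m / 2 ^ d * ε⁻¹ := by ring
  rw [e, mul_assoc] at hle
  have h1 := le_of_mul_le_mul_left (hle.trans_eq (mul_one _).symm) (by positivity)
  rw [inv_mul_le_iff₀ hε] at h1
  rw [e]
  linarith

/-- The radius is the square root of the Markov threshold. Both claims of (a) are deterministic
consequences of this single entrywise bound. -/
lemma concentration {m d : ℕ} (h : m ≤ d) {ρ : QMat d} (hρ : IsDensity ρ) {ε : ℝ} (hε : 0 < ε)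
    {p : UnitaryQ d → Prop}
    (hp : ∀ V, (∀ α β : Bits m, ‖(reducedState h V ρ - ((2 : ℂ) ^ m)⁻¹ • (1 : QMat m)) α β‖
      ≤ √(2 ^ m / ε) * (2 : ℝ) ^ (-(d : ℝ) / 2)) → p V) :
    1 - ε ≤ (haarU d).real {V | p V} := by
  refine (le_haarU_mixedDist_lt h hρ hε).trans (measureReal_mono fun V hV => hp V fun α β => ?_)
  refine (norm_sub_le_sqrt_mixedDist _ α β).trans ((Real.sqrt_le_sqrt hV.le).trans_eq ?_)
  rw [Real.sqrt_div' _ (by positivity), div_eq_mul_inv]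
  congr 1
  rw [neg_div, Real.rpow_neg (by norm_num), Real.sqrt_eq_rpow, ← Real.rpow_natCast,
    ← Real.rpow_mul (by norm_num), mul_one_div]

/-! ### The integral operator -/

lemma integralOp_apply {m : ℕ} {X : Type*} [MeasurableSpace X] (μ : Measure X) (σ : X → QMat m)
    (M : QMat m) (i j : Bits m) :
    integralOp μ σ M i j = ∑ k, ∑ l, (∫ y, σ y i j * σ y k l ∂μ) * M l k := by
  change ∑ k, (secondMoment μ σ * ((1 : QMat m) ⊗ₖ M)) (i, k) (j, k) = _
  refine Finset.sum_congr rfl fun k _ => ?_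
  rw [Matrix.mul_apply, Fintype.sum_prod_type, Finset.sum_eq_single j]
  · simp [secondMoment]
  · intro p _ hp
    simp [hp]
  · simp

lemma integral_trace_mul_trace {m : ℕ} {X : Type*} [MeasurableSpace X] {μ : Measure X}
    {σ : X → QMat m} (hσ : ∀ i j k l, Integrable (fun y => σ y i j * σ y k l) μ) (τ M : QMat m) :
    ∫ y, (τ * σ y).trace * (σ y * M).trace ∂μ = (τ * integralOp μ σ M).trace := by
  have e (y : X) : (τ * σ y).trace * (σ y * M).trace
      = ∑ i, ∑ j, ∑ k, ∑ l, σ y j i * σ y k l * (τ i j * M l k) := by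
    simp only [Matrix.trace, Matrix.diag, Matrix.mul_apply, Finset.sum_mul]
    simp only [Finset.mul_sum]
    refine Finset.sum_congr rfl fun i _ => Finset.sum_congr rfl fun j _ =>
      Finset.sum_congr rfl fun k _ => Finset.sum_congr rfl fun l _ => by ring
  have h4 (i j k l) := (hσ j i k l).mul_const (τ i j * M l k)
  have h3 (i j k) := integrable_finsetSum Finset.univ fun l _ => h4 i j k l
  have h2 (i j) := integrable_finsetSum Finset.univ fun k _ => h3 i j k
  have h1 (i) := integrable_finsetSum Finset.univ fun j _ => h2 i j
  simp only [e]
  rw [integral_finsetSum _ fun i _ => h1 i]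
  simp only [Matrix.trace, Matrix.diag, Matrix.mul_apply, integralOp_apply, Finset.mul_sum]
  refine Finset.sum_congr rfl fun i _ => ?_
  rw [integral_finsetSum _ fun j _ => h2 i j]
  refine Finset.sum_congr rfl fun j _ => ?_
  rw [integral_finsetSum _ fun k _ => h3 i j k]
  refine Finset.sum_congr rfl fun k _ => ?_
  rw [integral_finsetSum _ fun l _ => h4 i j k l]
  refine Finset.sum_congr rfl fun l _ => ?_
  rw [integral_mul_const]
  ring

lemma measurable_unitaryQ_apply {d : ℕ} (i j : Bits d) :
    Measurable fun V : UnitaryQ d => V.1 i j := by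
  have : Continuous fun V : UnitaryQ d => V.1 i j :=
    (continuous_apply j).comp ((continuous_apply i).comp continuous_subtype_val)
  exact this.measurable

/-- Joint measurability in the circuit and the data point is what Fubini needs to exchange the Haar
average with the `μ`-integral. -/
lemma measurable_reducedState_apply {m d : ℕ} (h : m ≤ d) {X : Type*} [MeasurableSpace X]
    {ρ : X → QMat d} (hρ : ∀ i j, Measurable fun x => ρ x i j) (α β : Bits m) :
    Measurable fun p : UnitaryQ d × X => reducedState h p.1 (ρ p.2) α β := by
  simp only [reducedState, reduced_apply, evolve_apply]
  refine Finset.measurable_sum _ fun s _ => Finset.measurable_sum _ fun b _ =>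
    Measurable.mul (Finset.measurable_sum _ fun a _ => ?_) ?_
  · exact ((measurable_unitaryQ_apply _ _).comp measurable_fst).mul
      ((hρ _ _).comp measurable_snd)
  · exact continuous_star.measurable.comp ((measurable_unitaryQ_apply _ _).comp measurable_fst)

lemma integrable_reducedState_mul {m d : ℕ} (h : m ≤ d) {X : Type*} [MeasurableSpace X]
    {ρ : X → QMat d} (hρ : ∀ i j, Measurable fun x => ρ x i j) (hd : ∀ x, IsDensity (ρ x))
    (ν : Measure (UnitaryQ d × X)) [IsFiniteMeasure ν] (i j k l : Bits m) :
    Integrable (fun p : UnitaryQ d × X =>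
      reducedState h p.1 (ρ p.2) i j * reducedState h p.1 (ρ p.2) k l) ν := by
  refine Integrable.of_bound ((measurable_reducedState_apply h hρ i j).mul
    (measurable_reducedState_apply h hρ k l)).aestronglyMeasurable 1 (.of_forall fun p => ?_)
  have hp := (hd p.2).reducedState h p.1
  rw [norm_mul]
  exact mul_le_one₀ (hp.norm_apply_le_one i j) (norm_nonneg _) (hp.norm_apply_le_one k l)

lemma integrable_reducedState_mul_right {m d : ℕ} (h : m ≤ d) {X : Type*} [MeasurableSpace X]
    {ρ : X → QMat d} (hρ : ∀ i j, Measurable fun x => ρ x i j) (hd : ∀ x, IsDensity (ρ x))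
    (μ : Measure X) [IsFiniteMeasure μ] (V : UnitaryQ d) (i j k l : Bits m) :
    Integrable (fun y => reducedState h V (ρ y) i j * reducedState h V (ρ y) k l) μ := by
  -- The slice at a fixed `V` is the joint statement for the pushforward of `μ` under `y ↦ (V, y)`.
  have hV : Measurable fun y : X => (V, y) := measurable_prodMk_left
  exact (integrable_reducedState_mul h hρ hd (μ.map fun y => (V, y)) i j k l).comp_measurable hV

lemma expectOp_apply {m : ℕ} {Ω : Type*} [MeasurableSpace Ω] (P : Measure Ω)
    (T : Ω → (QMat m →ₗ[ℂ] QMat m)) (M : QMat m) (i j : Bits m) :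
    expectOp P T M i j = ∑ p, ∑ q, (∫ ω, T ω (Matrix.single p q 1) i j ∂P) * M p q := by
  have hr (A : QMat m) (x : Bits m × Bits m) :
      (Matrix.stdBasis ℂ (Bits m) (Bits m)).repr A x = A x.1 x.2 := by
    simp [Matrix.stdBasis]
  rw [← hr (expectOp P T M) (i, j), expectOp, Matrix.toLin_apply]
  simp only [map_sum, map_smul, Finsupp.finsetSum_apply, Finsupp.smul_apply, Module.Basis.repr_self,
    Finsupp.single_apply]
  simp [Matrix.mulVec, dotProduct, hr, Fintype.sum_prod_type, LinearMap.toMatrix_apply,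
    Matrix.stdBasis_eq_single]

/-- For pure states the averaged integral operator is an explicit combination of the trace and
the identity. -/
lemma expectOp_projIntegralOp {m d : ℕ} (h : m ≤ d) {X : Type*} [MeasurableSpace X]
    (μ : Measure X) [IsProbabilityMeasure μ] {ρ : X → QMat d}
    (hm : ∀ i j, Measurable fun x => ρ x i j) (hd : ∀ x, IsDensity (ρ x))
    (hp : ∀ x, (ρ x * ρ x).trace = 1) (M : QMat m) :
    expectOp (haarU d) (projIntegralOp h μ ρ) M
      = ((((2 : ℝ) ^ d) ^ 2 + 2 ^ d)⁻¹ * (2 ^ (d - m)) ^ 2 : ℝ) • M.trace • (1 : QMat m)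
        + ((((2 : ℝ) ^ d) ^ 2 + 2 ^ d)⁻¹ * 2 ^ (d - m) : ℝ) • M := by
  -- Purity forces both coefficients to equal the solution of `a D² + a D = 1`, the same for every
  -- `x`.
  set a : ℝ := (((2 : ℝ) ^ d) ^ 2 + 2 ^ d)⁻¹ with ha
  have moment (x : X) (i j k l : Bits m) := integral_reducedState_mul (a := a) (b := a) h (by
    obtain ⟨a', b', -, -, hD, hpure, hab⟩ := exists_pairMoment_eq (hd x)
    have hab' : a' = b' := hpure (hp x)
    have : a' = a := by
      rw [ha, ← one_div, eq_div_iff (by positivity), ← hD, hab']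
      ring
    rwa [← hab', this] at hab) i j k l
  have key (i j p q : Bits m) :
      ∫ V, projIntegralOp h μ ρ V (Matrix.single p q 1) i j ∂haarU d
        = a * (2 ^ (d - m)) ^ 2 * ((if i = j then 1 else 0) * if q = p then 1 else 0)
          + a * 2 ^ (d - m) * ((if i = p then 1 else 0) * if j = q then 1 else 0) := by
    have e (V : UnitaryQ d) : projIntegralOp h μ ρ V (Matrix.single p q 1) i j
        = ∫ y, reducedState h V (ρ y) i j * reducedState h V (ρ y) q p ∂μ := by
      rw [projIntegralOp, integralOp_apply, Finset.sum_eq_single q, Finset.sum_eq_single p]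
      · simp
      · intro l _ hl
        simp [hl.symm]
      · simp
      · intro k _ hk
        simp [hk.symm]
      · simp
    simp only [e]
    -- After the exchange the inner Haar average is constant in `y`, so the probability measure `μ`
    -- drops out.
    rw [integral_integral_swap (integrable_reducedState_mul h hm hd _ i j q p)]
    simp only [moment]
    simp
  ext i j
  rw [expectOp_apply]
  simp only [key]
  simp only [add_mul, Finset.sum_add_distrib, mul_ite, ite_mul, mul_one, mul_zero, zero_mul,
    Finset.sum_ite_eq, Finset.sum_ite_eq', Finset.mem_univ, if_true, Matrix.add_apply,
    Matrix.smul_apply, Matrix.one_apply, Matrix.trace, Matrix.diag, Complex.real_smul, smul_eq_mul]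
  by_cases hij : i = j <;> simp [hij, Finset.mul_sum]

/-! ### Pauli strings -/

/-- The Pauli matrices, normalized for the Hilbert-Schmidt inner product. -/
noncomputable def pauli : Fin 4 → Matrix (Fin 2) (Fin 2) ℂ :=
  ![((√2 : ℝ) : ℂ)⁻¹ • 1, ((√2 : ℝ) : ℂ)⁻¹ • !![0, 1; 1, 0],
    ((√2 : ℝ) : ℂ)⁻¹ • !![0, -Complex.I; Complex.I, 0], ((√2 : ℝ) : ℂ)⁻¹ • !![1, 0; 0, -1]]

lemma star_pauli (s : Fin 4) (x y : Fin 2) : star (pauli s x y) = pauli s y x := by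
  fin_cases s <;> fin_cases x <;> fin_cases y <;> simp [pauli]

lemma sum_pauli_mul (s t : Fin 4) :
    ∑ x, ∑ y, pauli s x y * pauli t y x = if s = t then 1 else 0 := by
  have hr : ((√2 : ℝ) : ℂ)⁻¹ * ((√2 : ℝ) : ℂ)⁻¹ = 2⁻¹ := by
    rw [← mul_inv, ← Complex.ofReal_mul]; simp
  have hI := Complex.I_sq
  fin_cases s <;> fin_cases t <;> simp [pauli] <;> grind

/-- The normalized Pauli strings. -/
noncomputable def pauliString {m : ℕ} (s : Fin m → Fin 4) : QMat m :=
  Matrix.of fun x y => ∏ i, pauli (s i) (x i) (y i)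

lemma isHermitian_pauliString {m : ℕ} (s : Fin m → Fin 4) : (pauliString s).IsHermitian := by
  ext x y
  simp [pauliString, star_prod, star_pauli]

/-- The trace factorizes over the qubits, reducing orthonormality to that of single Pauli matrices.
-/
lemma trace_pauliString_mul {m : ℕ} (s t : Fin m → Fin 4) :
    ((pauliString s)ᴴ * pauliString t).trace = if s = t then 1 else 0 := by
  rw [(isHermitian_pauliString s).eq]
  simp only [Matrix.trace, Matrix.diag, Matrix.mul_apply, pauliString, Matrix.of_apply,
    ← Finset.prod_mul_distrib]
  have h1 (x : Bits m) : ∑ y : Bits m, ∏ i, pauli (s i) (x i) (y i) * pauli (t i) (y i) (x i)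
      = ∏ i, ∑ y, pauli (s i) (x i) y * pauli (t i) y (x i) := by
    rw [Finset.prod_univ_sum, Fintype.piFinset_univ]
  have h2 : ∑ x : Bits m, ∏ i, ∑ y, pauli (s i) (x i) y * pauli (t i) y (x i)
      = ∏ i, ∑ x, ∑ y, pauli (s i) x y * pauli (t i) y x := by
    rw [Finset.prod_univ_sum, Fintype.piFinset_univ]
  simp only [h1, h2, sum_pauli_mul]
  by_cases hst : s = t
  · simp [hst]
  · obtain ⟨i, hi⟩ := Function.ne_iff.1 hst
    rw [if_neg hst]
    exact Finset.prod_eq_zero (Finset.mem_univ i) (if_neg hi)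

lemma pauliString_zero (m : ℕ) :
    pauliString (0 : Fin m → Fin 4) = (((√2 : ℝ)⁻¹ ^ m : ℝ) : ℂ) • (1 : QMat m) := by
  ext x y
  simp only [pauliString, Matrix.of_apply, Pi.zero_apply, pauli, Matrix.cons_val_zero,
    Matrix.smul_apply, Matrix.one_apply, smul_eq_mul, Finset.prod_mul_distrib, Finset.prod_const,
    Finset.card_univ, Fintype.card_fin]
  rw [Finset.prod_ite_zero]
  simp [funext_iff]

/-- This is orthogonality to the zero string, a nonzero multiple of the identity. -/
lemma trace_pauliString {m : ℕ} {s : Fin m → Fin 4} (hs : s ≠ 0) : (pauliString s).trace = 0 := by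
  have h := trace_pauliString_mul 0 s
  rw [pauliString_zero, if_neg hs.symm, Matrix.conjTranspose_smul, Matrix.conjTranspose_one,
    Matrix.smul_mul, Matrix.one_mul, Matrix.trace_smul, smul_eq_mul] at h
  refine (mul_eq_zero.1 h).resolve_left ?_
  exact star_ne_zero.2 (Complex.ofReal_ne_zero.2 (by positivity))

lemma exists_pauliString_index (m : ℕ) :
    ∃ e : Option (Fin (2 ^ (2 * m) - 1)) ≃ (Fin m → Fin 4), e none = 0 := by
  have hc : Fintype.card (Option (Fin (2 ^ (2 * m) - 1))) = Fintype.card (Fin m → Fin 4) := by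
    have : 0 < 2 ^ (2 * m) := by positivity
    rw [Fintype.card_option, Fintype.card_fin, Nat.sub_add_cancel this, Fintype.card_fun,
      Fintype.card_fin, Fintype.card_fin, pow_mul]
    norm_num
  let e := Fintype.equivOfCardEq hc
  -- An arbitrary bijection is corrected by a transposition so that `none` labels the identity
  -- string.
  exact ⟨e.trans (Equiv.swap (e none) 0), by simp⟩

lemma spectrum_expectOp {m d : ℕ} (h : m ≤ d) {X : Type*} [MeasurableSpace X]
    (μ : Measure X) [IsProbabilityMeasure μ] {ρ : X → QMat d}
    (hm : ∀ i j, Measurable fun x => ρ x i j) (hd : ∀ x, IsDensity (ρ x))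
    (hp : ∀ x, (ρ x * ρ x).trace = 1) :
    expectOp (haarU d) (projIntegralOp h μ ρ) (pauliString 0)
        = (((2 : ℝ) ^ m)⁻¹ : ℝ) • pauliString 0 ∧
      ∀ s : Fin m → Fin 4, s ≠ 0 → expectOp (haarU d) (projIntegralOp h μ ρ) (pauliString s)
        = (((2 : ℝ) ^ m * (2 ^ d + 1))⁻¹ : ℝ) • pauliString s := by
  have hd' : (2 : ℝ) ^ d = 2 ^ m * 2 ^ (d - m) := by rw [← pow_add, Nat.add_sub_of_le h]
  constructor
  · have e : ((((2 : ℝ) ^ d) ^ 2 + 2 ^ d)⁻¹ * (2 ^ (d - m)) ^ 2) * 2 ^ m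
        + (((2 : ℝ) ^ d) ^ 2 + 2 ^ d)⁻¹ * 2 ^ (d - m) = (2 ^ m)⁻¹ := by
      rw [hd']
      field_simp
    rw [expectOp_projIntegralOp h μ hm hd hp, pauliString_zero, Matrix.trace_smul,
      Matrix.trace_one, card_bits, ← e]
    ext i j
    simp only [Matrix.add_apply, Matrix.smul_apply, Complex.real_smul, smul_eq_mul]
    push_cast
    ring
  · intro s hs
    rw [expectOp_projIntegralOp h μ hm hd hp, trace_pauliString hs, zero_smul, smul_zero, zero_add,
      hd']
    congr 1
    field_simp

theorem theorem2 (m : ℕ) :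
    -- (a) the reduced density matrix and the projected kernel concentrate
    (∀ ε : ℝ, 0 < ε → ∃ C : ℝ, ∀ (d : ℕ) (h : m ≤ d) (X : Type*) (ρ : X → QMat d),
      (∀ x, IsDensity (ρ x)) →
      (∀ x, 1 - ε ≤ (haarU d).real {V : UnitaryQ d | ∀ α β : Bits m,
        ‖(reducedState h V (ρ x) - ((2 : ℂ) ^ m)⁻¹ • (1 : QMat m)) α β‖
          ≤ C * (2 : ℝ) ^ (-(d : ℝ) / 2)}) ∧
      (∀ x x', 1 - ε ≤ (haarU d).real {V : UnitaryQ d |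
        ‖projKernel h ρ V x x' - ((2 : ℂ) ^ m)⁻¹‖ ≤ C * (2 : ℝ) ^ (-(d : ℝ) / 2)})) ∧
    -- (b) the spectrum of the averaged integral operator
    (∃ C : ℝ, ∀ (d : ℕ) (h : m ≤ d) (X : Type*) [MeasurableSpace X] (μ : Measure X)
      [IsProbabilityMeasure μ] (ρ : X → QMat d),
      (∀ i j, Measurable fun x => ρ x i j) → (∀ x, IsDensity (ρ x)) →
      (∀ x, (ρ x * ρ x).trace = 1) →
      -- the linear maps act as the integral operators of the projected kernels
      (∀ (V : UnitaryQ d) (M : QMat m) (x : X),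
        ∫ y, projKernel h ρ V x y * (reducedState h V (ρ y) * M).trace ∂μ
          = (reducedState h V (ρ x) * projIntegralOp h μ ρ V M).trace) ∧
      -- orthonormal Hermitian eigenbasis of the averaged operator, `none` being the special index
      ∃ (γ : Option (Fin (2 ^ (2 * m) - 1)) → ℝ) (A : Option (Fin (2 ^ (2 * m) - 1)) → QMat m),
        (∀ i, (A i).IsHermitian) ∧
        (∀ i j, ((A i)ᴴ * A j).trace = if i = j then 1 else 0) ∧
        (∀ i, expectOp (haarU d) (projIntegralOp h μ ρ) (A i) = (γ i : ℂ) • A i) ∧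
        |γ none - ((2 : ℝ) ^ m)⁻¹| ≤ C * ((2 : ℝ) ^ (2 * d))⁻¹ ∧
        (∀ i, |γ (some i) - ((2 : ℝ) ^ (m + d))⁻¹| ≤ C * ((2 : ℝ) ^ (2 * d))⁻¹) ∧
        -- the eigenfunction of `γ none` is constant up to a relative error `O(2^(-2d))`
        ∃ c : ℝ, c ≠ 0 ∧ ∀ (V : UnitaryQ d) (x : X),
          ‖(reducedState h V (ρ x) * A none).trace - (c : ℂ)‖
            ≤ C * |c| * ((2 : ℝ) ^ (2 * d))⁻¹) := by
  constructor
  · intro ε hε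
    -- The factor `(2 ^ m) ^ 2` counts the matrix entries in the trace estimate for the kernel; the
    -- entrywise claim does not need it.
    refine ⟨(2 ^ m) ^ 2 * √(2 ^ m / ε), fun d h X ρ hρ => ⟨fun x => ?_, fun x x' => ?_⟩⟩
    · refine concentration h (hρ x) hε fun V hV α β => (hV α β).trans ?_
      rw [mul_assoc]
      exact le_mul_of_one_le_left (by positivity)
        (one_le_pow₀ (one_le_pow₀ (by norm_num)))
    · refine concentration h (hρ x) hε fun V hV => ?_
      rw [mul_assoc]
      exact norm_trace_mul_sub_le ((hρ x').reducedState h V) hV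
  -- The constant `1` suffices: the leading eigenvalue and its constant eigenfunction are exact, and
  -- the other eigenvalues are off by `1/(N D (D + 1)) ≤ 1/D²`.
  · refine ⟨1, fun d h X _ μ _ ρ hm hd hp => ⟨fun V M x => ?_, ?_⟩⟩
    · exact integral_trace_mul_trace
        (fun i j k l => integrable_reducedState_mul_right h hm hd μ V i j k l) _ M
    obtain ⟨e, he⟩ := exists_pauliString_index m
    obtain ⟨h0, hs⟩ := spectrum_expectOp h μ hm hd hp
    refine ⟨fun i => i.elim ((2 : ℝ) ^ m)⁻¹ fun _ => ((2 : ℝ) ^ m * (2 ^ d + 1))⁻¹,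
      fun i => pauliString (e i), fun i => isHermitian_pauliString _, fun i j => ?_, ?_, ?_, ?_,
      (√2)⁻¹ ^ m, by positivity, fun V x => ?_⟩
    · rw [trace_pauliString_mul]
      simp only [e.injective.eq_iff]
    · rintro (_ | i)
      · beta_reduce
        rw [he]
        exact h0
      · exact hs _ fun h => by simpa using e.injective (h.trans he.symm)
    · simp
    · intro i
      change |((2 : ℝ) ^ m * (2 ^ d + 1))⁻¹ - _| ≤ _
      have hN : (1 : ℝ) ≤ 2 ^ m := one_le_pow₀ (by norm_num)
      have hD : (1 : ℝ) ≤ 2 ^ d := one_le_pow₀ (by norm_num)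
      rw [pow_add, mul_comm 2 d, pow_mul, one_mul, abs_sub_comm]
      set N : ℝ := 2 ^ m
      set D : ℝ := 2 ^ d
      have e1 : (N * D)⁻¹ - (N * (D + 1))⁻¹ = (N * (D * (D + 1)))⁻¹ := by
        field_simp
        ring
      rw [e1, abs_of_nonneg (by positivity)]
      refine inv_anti₀ (by positivity) ?_
      nlinarith
    · have ht : (reducedState h V (ρ x)).trace = 1 := ((hd x).reducedState h V).2
      simp only [he, pauliString_zero, Matrix.mul_smul, Matrix.trace_smul, ht,
        smul_eq_mul, mul_one, sub_self, norm_zero]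
      positivity
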